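/- All graphs are finite, undirected, without loops or multiple edges. A \emph{polyhedron} is a planar, $3$-connected graph, and for a graph $G$ put $$A(G)=\{a : \text{there are distinct } u,v\in V(G) \text{ with exactly } a \text{ common neighbours}\}.$$ The \emph{$n$-gonal pyramid} ($n\ge 3$) consists of a cycle on $n$ vertices (its base) together with one further vertex adjacent to all vertices of the cycle. A \emph{caterpillar} is a tree such that deleting its vertices of degree $1$ leaves a path with at least one vertex. \textbf{Proposition.} For every finite non-empty set $A'_4$ of integers $\ge 4$ there are infinitely many pairwise non-isomorphic polyhedra $G$ satisfying $$A(G)=\{1,2,3\}\cup A'_4 .$$ Moreover, infinitely many pairwise non-isomorphic such $G$ can be obtained from pyramids by adding to the base the edges of a caterpillar, whose vertices are base vertices and none of whose edges is an edge of the base cycle. -/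

import Mathlib

namespace PolyhedronType

/-- A plane drawing of a graph: vertices are distinct points of the plane, every edge is a simple
arc joining the points of its two endpoints, an arc meets no vertex other than its endpoints, and
two different arcs meet only at vertices. -/
structure PlaneDrawing {V : Type*} (G : SimpleGraph V) where
  point : V → EuclideanSpace ℝ (Fin 2)
  arc : G.edgeSet → unitInterval → EuclideanSpace ℝ (Fin 2)
  point_injective : Function.Injective point
  arc_continuous : ∀ e, Continuous (arc e)
  arc_injective : ∀ e, Function.Injective (arc e)
  arc_ends : ∀ e, s(arc e 0, arc e 1) = (e : Sym2 V).map point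
  arc_avoids : ∀ e t v, arc e t = point v → v ∈ (e : Sym2 V)
  arc_cross : ∀ e e', e ≠ e' → ∀ s t, arc e s = arc e' t → ∃ v, arc e s = point v

/-- A graph is planar if it has a plane drawing. -/
def IsPlanar {V : Type*} (G : SimpleGraph V) : Prop :=
  Nonempty (PlaneDrawing G)

/-- A finite graph is `k`-connected if it has at least `k + 1` vertices and removing any fewer
than `k` vertices leaves a connected graph. -/
def IsVertexConnected {V : Type*} [Fintype V] (k : ℕ) (G : SimpleGraph V) : Prop :=
  k + 1 ≤ Fintype.card V ∧
    ∀ S : Finset V, S.card < k → (G.induce ((S : Set V)ᶜ)).Connected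

/-- A polyhedron (polyhedral graph): a finite planar 3-connected graph. -/
def IsPolyhedron {V : Type*} [Fintype V] (G : SimpleGraph V) : Prop :=
  IsPlanar G ∧ IsVertexConnected 3 G

/-- The type `A(G)`: the set of numbers of common neighbours of pairs of distinct vertices. -/
def graphType {V : Type*} (G : SimpleGraph V) : Set ℕ :=
  {a | ∃ u v : V, u ≠ v ∧ (G.commonNeighbors u v).ncard = a}

/-- A caterpillar: a finite tree such that deleting the vertices of degree `1` leaves a path
(with at least one vertex). -/
def IsCaterpillar {V : Type*} [Finite V] (T : SimpleGraph V) : Prop :=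
  T.IsTree ∧ ∃ m : ℕ, 1 ≤ m ∧
    Nonempty (T.induce {v | (T.neighborSet v).ncard ≠ 1} ≃g SimpleGraph.pathGraph m)

/-- The cone over a graph `H`: a new vertex, the apex `none`, is joined to all vertices of `H`. -/
def cone {V : Type*} (H : SimpleGraph V) : SimpleGraph (Option V) where
  Adj
    | none, none => False
    | none, some _ => True
    | some _, none => True
    | some x, some y => H.Adj x y
  symm := ⟨by
    rintro (_ | x) (_ | y) h
    · exact h
    · trivial
    · trivial
    · exact SimpleGraph.Adj.symm h⟩
  loopless := ⟨by
    rintro (_ | x) h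
    · exact h
    · exact H.loopless.irrefl x h⟩

/-- The `n`-gonal pyramid is `cone (cycleGraph n)`, `n ≥ 3`. A graph is obtained from a pyramid by
adding the edges of a caterpillar to its base if, up to isomorphism, it is `cone (cycleGraph n)`
with the edges of a caterpillar `T` added, where the vertices of `T` are (placed injectively at)
base vertices and no edge of `T` is already an edge of the base. -/
def IsPyramidWithCaterpillar {V : Type*} (G : SimpleGraph V) : Prop :=
  ∃ n : ℕ, 3 ≤ n ∧ ∃ (k : ℕ) (T : SimpleGraph (Fin k)) (f : Fin k ↪ Fin n),
    IsCaterpillar T ∧ Disjoint (T.map f) (SimpleGraph.cycleGraph n) ∧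
    Nonempty (G ≃g cone (SimpleGraph.cycleGraph n ⊔ T.map f))

end PolyhedronType

/-! Number the base cycle `0, …, n - 1` and add chords that do not cross in this linear order. In
the cone, the apex and a base vertex have as many common neighbours as the degree of that vertex in
the base graph `H`; two base vertices have one more than in `H` (`mem_graphType_cone`). Since the
edges of `H` do not cross, two vertices have at most two common neighbours in `H`, so such pairs
contribute only 1, 2 or 3 (`Noncrossing.ncard_commonNeighbors_le`). Every value above 3 is therefore
a degree, and degrees can be prescribed.

The chords form a caterpillar with spine `0, M, …, m * M`. Its inner spine vertex `i * M` has two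
spine neighbours and `c i - 1` leaves; with the two cycle edges its degree in `H` is `c i + 3`. All
other vertices have degree 2 or 3. Choosing `c` realises exactly the given set
(`exists_chordParams`), and lengthening the chord-free stretch of the cycle gives infinitely many
orders.

Planarity comes from an explicit drawing: base vertices on the axis, edges of `H` as parabolic arcs
above it, the apex below. Connectivity uses only that `H` contains the cycle. -/

namespace PolyhedronType

/-! ### Plane drawings of cones over graphs without crossing edges -/

/-- The point of the plane that represents the apex (`none`) or a base vertex. -/
noncomputable def basePoint : Option ℕ → EuclideanSpace ℝ (Fin 2)
  | none => !₂[0, -1]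
  | some k => !₂[(k : ℝ), 0]

/-- The segment from the apex to `b`, or the parabolic arc above the axis from `a` to `b`. -/
noncomputable def baseCurve : Option ℕ → ℕ → ℝ → EuclideanSpace ℝ (Fin 2)
  | none, b, t => !₂[b * t, -1 + t]
  | some a, b, t => !₂[a + (b - a) * t, ((b : ℝ) - a) ^ 2 * (t * (1 - t))]

theorem vec2_eq_iff {a b c d : ℝ} :
    (!₂[a, b] : EuclideanSpace ℝ (Fin 2)) = !₂[c, d] ↔ a = c ∧ b = d := by
  constructor
  · intro h
    have h0 := congrArg (fun v : EuclideanSpace ℝ (Fin 2) => v 0) h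
    have h1 := congrArg (fun v : EuclideanSpace ℝ (Fin 2) => v 1) h
    exact ⟨by simpa using h0, by simpa using h1⟩
  · rintro ⟨rfl, rfl⟩
    rfl

theorem basePoint_injective : Function.Injective basePoint := by
  rintro (_ | a) (_ | b) h
  · rfl
  · simp [basePoint] at h
  · simp [basePoint] at h
  · simpa [basePoint, vec2_eq_iff] using h

theorem continuous_baseCurve (p : Option ℕ) (b : ℕ) : Continuous (baseCurve p b) := by
  cases p <;>
  · refine (PiLp.continuous_toLp 2 _).comp (continuous_pi fun i => ?_)
    fin_cases i <;> simp <;> fun_prop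

theorem baseCurve_zero (p : Option ℕ) (b : ℕ) : baseCurve p b 0 = basePoint p := by
  cases p <;> simp [baseCurve, basePoint]

theorem baseCurve_one (p : Option ℕ) (b : ℕ) : baseCurve p b 1 = basePoint (some b) := by
  cases p <;> simp [baseCurve, basePoint]

theorem baseCurve_injective {p : Option ℕ} {b : ℕ} (hp : ∀ a ∈ p, a < b) :
    Function.Injective (baseCurve p b) := by
  intro s t h
  cases p with
  | none => simpa [baseCurve, vec2_eq_iff] using (vec2_eq_iff.1 h).2
  | some a =>
    have hab : (a : ℝ) < b := by exact_mod_cast hp a rfl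
    have h0 := (vec2_eq_iff.1 h).1
    exact mul_left_cancel₀ (sub_pos.2 hab).ne' (add_left_cancel h0)

/-- Heights decide: all vertices lie at height 0 or -1, an open segment lies strictly between these
heights, and an open arc strictly above 0. -/
theorem baseCurve_eq_basePoint {p r : Option ℕ} {b : ℕ} (hp : ∀ a ∈ p, a < b) {t : ℝ}
    (ht : 0 ≤ t) (ht' : t ≤ 1) (h : baseCurve p b t = basePoint r) : t = 0 ∨ t = 1 := by
  cases p with
  | none =>
    cases r with
    | none => left; linarith [(vec2_eq_iff.1 h).2]
    | some c => right; linarith [(vec2_eq_iff.1 h).2]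
  | some a =>
    have hab : (a : ℝ) < b := by exact_mod_cast hp a rfl
    cases r with
    | none =>
      have h1 := (vec2_eq_iff.1 h).2
      linarith [mul_nonneg (sq_nonneg ((b : ℝ) - a)) (mul_nonneg ht (sub_nonneg.2 ht'))]
    | some c =>
      have h1 := (vec2_eq_iff.1 h).2
      have h2 : ((b : ℝ) - a) ^ 2 ≠ 0 := pow_ne_zero _ (sub_pos.2 hab).ne'
      rcases mul_eq_zero.1 ((mul_eq_zero.1 h1).resolve_left h2) with h3 | h3
      · exact Or.inl h3
      · right; linarith

/-- Two parabolic arcs over intervals of the axis that do not cross meet only at end points. -/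
theorem parabola_meet {a b c d s t : ℝ} (hcd : c < d) (hs' : s ≤ 1)
    (ht : 0 ≤ t) (ht' : t ≤ 1) (h : b ≤ c ∧ a < b ∨ (a ≤ c ∧ d ≤ b ∧ ¬(a = c ∧ b = d)))
    (hx : a + (b - a) * s = c + (d - c) * t)
    (hy : (b - a) ^ 2 * (s * (1 - s)) = (d - c) ^ 2 * (t * (1 - t))) :
    (s = 0 ∨ s = 1) ∨ (t = 0 ∨ t = 1) := by
  rcases h with ⟨hbc, hab⟩ | ⟨hac, hdb, hne⟩
  · left; right
    have h1 : (d - c) * t ≥ 0 := mul_nonneg (sub_pos.2 hcd).le ht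
    have h2 : (b - a) * (1 - s) ≤ 0 := by linarith
    have h3 : 1 - s ≤ 0 := by
      by_contra! h3
      linarith [mul_pos (sub_pos.2 hab) h3]
    linarith
  · right
    -- Over abscissa `x` the arcs have heights `(x - a) * (b - x)` and `(x - c) * (d - x)`. Their
    -- difference is affine in `x`, hence interpolates its nonnegative values at `c` and `d`.
    have key : (1 - t) * ((c - a) * (b - c)) + t * ((d - a) * (b - d)) = 0 := by
      have e1 : (b - a) ^ 2 * (s * (1 - s)) =
          ((a + (b - a) * s) - a) * (b - (a + (b - a) * s)) := by ring
      rw [e1, hx] at hy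
      linear_combination hy
    have n1 : 0 ≤ (1 - t) * ((c - a) * (b - c)) :=
      mul_nonneg (by linarith) (mul_nonneg (by linarith) (by linarith))
    have n2 : 0 ≤ t * ((d - a) * (b - d)) :=
      mul_nonneg ht (mul_nonneg (by linarith) (by linarith))
    have z1 : (1 - t) * ((c - a) * (b - c)) = 0 := by linarith
    have z2 : t * ((d - a) * (b - d)) = 0 := by linarith
    by_contra! hc
    have hca : c = a := by
      rcases mul_eq_zero.1 z1 with h | h
      · exact absurd (by linarith) hc.2
      · rcases mul_eq_zero.1 h with h | h <;> linarith
    have hbd : b = d := by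
      rcases mul_eq_zero.1 z2 with h | h
      · exact absurd h hc.1
      · rcases mul_eq_zero.1 h with h | h <;> linarith
    exact hne ⟨hca.symm, hbd⟩

/-- Two apex segments meet at equal height, so at equal parameter; a segment and an arc are
separated by the axis; two noncrossing arcs span intervals that are nested or have disjoint
interiors, which is `parabola_meet`. -/
theorem baseCurve_meet {p q : Option ℕ} {b d : ℕ} (hp : ∀ a ∈ p, a < b) (hq : ∀ c ∈ q, c < d)
    (hne : ¬(p = q ∧ b = d)) (h₁ : ∀ a ∈ p, ∀ c ∈ q, ¬(a < c ∧ c < b ∧ b < d))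
    (h₂ : ∀ a ∈ p, ∀ c ∈ q, ¬(c < a ∧ a < d ∧ d < b)) {s t : ℝ} (hs : 0 ≤ s) (hs' : s ≤ 1)
    (ht : 0 ≤ t) (ht' : t ≤ 1) (h : baseCurve p b s = baseCurve q d t) :
    (s = 0 ∨ s = 1) ∨ (t = 0 ∨ t = 1) := by
  rcases p with _ | a <;> rcases q with _ | c
  · obtain ⟨hx, hy⟩ := vec2_eq_iff.1 h
    have hst : s = t := by linarith
    subst hst
    left; left
    by_contra hs0
    exact hne ⟨rfl, by exact_mod_cast mul_right_cancel₀ hs0 hx⟩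
  · have hy := (vec2_eq_iff.1 h).2
    have : 0 ≤ ((d : ℝ) - c) ^ 2 * (t * (1 - t)) :=
      mul_nonneg (sq_nonneg _) (mul_nonneg ht (by linarith))
    left; right; linarith
  · have hy := (vec2_eq_iff.1 h).2
    have : 0 ≤ ((b : ℝ) - a) ^ 2 * (s * (1 - s)) :=
      mul_nonneg (sq_nonneg _) (mul_nonneg hs (by linarith))
    right; right; linarith
  · obtain ⟨hx, hy⟩ := vec2_eq_iff.1 h
    have hab : a < b := hp a rfl
    have hcd : c < d := hq c rfl
    have hn1 := h₁ a rfl c rfl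
    have hn2 := h₂ a rfl c rfl
    have hne' : ¬(a = c ∧ b = d) := fun e => hne ⟨by rw [e.1], e.2⟩
    have hab' : (a : ℝ) < b := by exact_mod_cast hab
    have hcd' : (c : ℝ) < d := by exact_mod_cast hcd
    have hcases : (b ≤ c ∨ (a ≤ c ∧ d ≤ b)) ∨ (d ≤ a ∨ (c ≤ a ∧ b ≤ d)) := by omega
    rcases hcases with hcases | hcases
    · refine parabola_meet hcd' hs' ht ht' ?_ hx hy
      rcases hcases with h | h
      · exact Or.inl ⟨by exact_mod_cast h, hab'⟩
      · exact Or.inr ⟨by exact_mod_cast h.1, by exact_mod_cast h.2, by exact_mod_cast hne'⟩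
    · refine (parabola_meet hab' ht' hs hs' ?_ hx.symm hy.symm).symm
      rcases hcases with h | h
      · exact Or.inl ⟨by exact_mod_cast h, hcd'⟩
      · exact Or.inr ⟨by exact_mod_cast h.1, by exact_mod_cast h.2, fun e =>
          hne' ⟨by exact_mod_cast e.1.symm, by exact_mod_cast e.2.symm⟩⟩

/-- A graph is planar if all its vertices but at most one (the apex, at position `none`) can be
placed at integers so that no two edges between them cross. -/
theorem isPlanar_of_noncrossing {V : Type*} (G : SimpleGraph V) (pos : V → Option ℕ)
    (hpos : Function.Injective pos)
    (hnc : ∀ u v w z, G.Adj u v → G.Adj w z → ∀ a ∈ pos u, ∀ b ∈ pos v, ∀ c ∈ pos w,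
      ∀ d ∈ pos z, ¬(a < c ∧ c < b ∧ b < d)) : IsPlanar G := by
  have orient : ∀ e : G.edgeSet, ∃ u v : V, ∃ b : ℕ, (e : Sym2 V) = s(u, v) ∧ G.Adj u v ∧
      pos v = some b ∧ ∀ a ∈ pos u, a < b := by
    rintro ⟨e, he⟩
    induction e using Sym2.ind with
    | _ x y =>
      have hxy : G.Adj x y := he
      rcases hx : pos x with _ | a <;> rcases hy : pos y with _ | b
      · exact absurd (hpos (hx.trans hy.symm)) hxy.ne
      · exact ⟨x, y, b, rfl, hxy, hy, by simp [hx]⟩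
      · exact ⟨y, x, a, Sym2.eq_swap, hxy.symm, hx, by simp [hy]⟩
      · have hab : a ≠ b := fun h => hxy.ne (hpos (by rw [hx, hy, h]))
        rcases lt_or_gt_of_ne hab with h | h
        · exact ⟨x, y, b, rfl, hxy, hy, by simpa [hx] using h⟩
        · exact ⟨y, x, a, Sym2.eq_swap, hxy.symm, hx, by simpa [hy] using h⟩
  choose u v b he hadj hv hu using orient
  have hends : ∀ (e : G.edgeSet) (t : ℝ), t = 0 ∨ t = 1 →
      ∃ w ∈ (e : Sym2 V), baseCurve (pos (u e)) (b e) t = basePoint (pos w) := by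
    rintro e t (rfl | rfl)
    · exact ⟨u e, by rw [he e]; simp, baseCurve_zero _ _⟩
    · exact ⟨v e, by rw [he e]; simp, by rw [baseCurve_one, hv]⟩
  refine ⟨⟨fun x => basePoint (pos x), fun e t => baseCurve (pos (u e)) (b e) t,
    basePoint_injective.comp hpos,
    fun e => (continuous_baseCurve _ _).comp continuous_subtype_val,
    fun e => (baseCurve_injective (hu e)).comp Subtype.val_injective, fun e => ?_,
    fun e t w h => ?_, fun e e' hee s t h => ?_⟩⟩
  · have h0 : baseCurve (pos (u e)) (b e) ((0 : unitInterval) : ℝ) = basePoint (pos (u e)) :=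
      baseCurve_zero _ _
    have h1 : baseCurve (pos (u e)) (b e) ((1 : unitInterval) : ℝ) = basePoint (pos (v e)) := by
      rw [hv]; exact baseCurve_one _ _
    rw [h0, h1, he e, Sym2.map_mk]
  · obtain ⟨z, hz, hz'⟩ := hends e t (baseCurve_eq_basePoint (hu e) t.2.1 t.2.2 h)
    have : z = w := hpos (basePoint_injective (hz'.symm.trans h))
    exact this ▸ hz
  · have hm := baseCurve_meet (hu e) (hu e') (fun hc => hee ?_)
      (fun x hx y hy => hnc _ _ _ _ (hadj e) (hadj e') x hx _ (hv e) y hy _ (hv e'))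
      (fun x hx y hy => hnc _ _ _ _ (hadj e') (hadj e) y hy _ (hv e') x hx _ (hv e))
      s.2.1 s.2.2 t.2.1 t.2.2 h
    · rcases hm with hm | hm
      · obtain ⟨w, -, hw⟩ := hends e s hm
        exact ⟨w, hw⟩
      · obtain ⟨w, -, hw⟩ := hends e' t hm
        exact ⟨w, h.trans hw⟩
    · apply Subtype.ext
      rw [he e, he e', hpos hc.1, hpos ((hv e).trans ((congrArg some hc.2).trans (hv e').symm))]

end PolyhedronType

namespace PolyhedronType

/-! ### Connectivity and common neighbours in cones -/

open scoped Fin.NatCast in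
/-- After deleting a vertex `k`, every vertex of a cycle other than `k` is joined to `k + 1`. -/
theorem reachable_cycleGraph_induce {n : ℕ} {W : Set (Fin (n + 3))} (k : Fin (n + 3))
    (hW : ∀ x, x ≠ k → x ∈ W) (x : W) :
    ((SimpleGraph.cycleGraph (n + 3)).induce W).Reachable
      ⟨k + 1, hW _ (by simp)⟩ x := by
  -- Walk upwards from `k + 1`; the bound on `i` stops the walk before it returns to `k`.
  have step : ∀ i : ℕ, i < n + 2 → ∀ hi : k + 1 + (i : Fin (n + 3)) ∈ W,
      ((SimpleGraph.cycleGraph (n + 3)).induce W).Reachable ⟨k + 1, hW _ (by simp)⟩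
        ⟨k + 1 + (i : Fin (n + 3)), hi⟩ := by
    intro i
    induction i with
    | zero =>
      intro _ hi
      simp
    | succ i ih =>
      intro hlt hi
      have hmem : k + 1 + (i : Fin (n + 3)) ∈ W := by
        apply hW
        intro h
        rw [add_assoc, add_eq_left] at h
        have := congrArg Fin.val h
        rw [← Nat.cast_one, ← Nat.cast_add, Fin.val_natCast, Nat.mod_eq_of_lt (by omega)] at this
        simp at this
      refine (ih (by omega) hmem).trans (SimpleGraph.Adj.reachable ?_)
      simp [SimpleGraph.cycleGraph_adj, add_assoc]
  -- `k` itself may belong to `W`; it is then a neighbour of `k + 1`.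
  by_cases hx : (x : Fin (n + 3)) = k
  · refine SimpleGraph.Adj.reachable ?_
    simp [SimpleGraph.cycleGraph_adj, hx]
  · have hval : k + 1 + (((x : Fin (n + 3)) - (k + 1)).val : Fin (n + 3)) = x := by
      rw [Fin.cast_val_eq_self]; abel
    have hlt : ((x : Fin (n + 3)) - (k + 1)).val < n + 2 := by
      have h1 := ((x : Fin (n + 3)) - (k + 1)).isLt
      have h2 : ((x : Fin (n + 3)) - (k + 1)).val ≠ n + 2 := by
        intro h
        apply hx
        rw [← hval, h]
        have : ((n + 2 : ℕ) : Fin (n + 3)) + 1 = 0 := by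
          rw [← Nat.cast_one, ← Nat.cast_add]
          simp
        rw [add_assoc, add_comm 1, this, add_zero]
      omega
    have h := step _ hlt (by rw [hval]; exact x.2)
    convert h
    exact hval.symm

/-- If the apex survives, it is adjacent to everything left. Otherwise at most one base vertex is
deleted, and a cycle minus a vertex is connected. -/
theorem isVertexConnected_cone {n : ℕ} (H : SimpleGraph (Fin (n + 3)))
    (hH : SimpleGraph.cycleGraph (n + 3) ≤ H) : IsVertexConnected 3 (cone H) := by
  refine ⟨by simp, fun S hS => ?_⟩
  by_cases hnone : none ∈ S
  · obtain ⟨k, hk⟩ : ∃ k : Fin (n + 3), S ⊆ {none, some k} := by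
      have hcard : (S.erase none).card ≤ 1 := by
        rw [Finset.card_erase_of_mem hnone]; omega
      obtain ⟨y, hy⟩ := Finset.card_le_one_iff_subset_singleton.1 hcard
      -- If `y` is `none`, no base vertex is deleted and the default 0 is harmless.
      refine ⟨y.getD 0, fun z hz => ?_⟩
      rcases z with _ | z
      · simp
      · have := hy (Finset.mem_erase.2 ⟨by simp, hz⟩)
        rw [Finset.mem_singleton] at this
        simp [← this]
    have hW : ∀ x, x ≠ k → x ∈ {x : Fin (n + 3) | some x ∈ (S : Set (Option (Fin (n + 3))))ᶜ} := by
      intro x hx hxS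
      have := hk hxS
      simp [hx] at this
    let φ : (SimpleGraph.cycleGraph (n + 3)).induce
        {x : Fin (n + 3) | some x ∈ (S : Set (Option (Fin (n + 3))))ᶜ} →g
        (cone H).induce ((S : Set (Option (Fin (n + 3))))ᶜ) :=
      ⟨fun x => ⟨some x, x.2⟩, fun h => hH h⟩
    refine SimpleGraph.connected_iff_exists_forall_reachable _ |>.2
      ⟨⟨some (k + 1), hW _ (by simp)⟩, ?_⟩
    rintro ⟨_ | x, hx⟩
    · exact absurd hnone hx
    · exact (reachable_cycleGraph_induce k hW ⟨x, hx⟩).map φ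
  · refine SimpleGraph.connected_iff_exists_forall_reachable _ |>.2 ⟨⟨none, hnone⟩, ?_⟩
    rintro ⟨_ | x, hx⟩
    · exact SimpleGraph.Reachable.refl _
    · exact SimpleGraph.Adj.reachable (show (cone H).Adj none (some x) from trivial)

theorem commonNeighbors_cone_none {V : Type*} (H : SimpleGraph V) (x : V) :
    (cone H).commonNeighbors none (some x) = some '' H.neighborSet x := by
  ext (_ | y)
  · simp [SimpleGraph.mem_commonNeighbors, cone]
  · simp [SimpleGraph.mem_commonNeighbors, cone]

theorem commonNeighbors_cone_some {V : Type*} (H : SimpleGraph V) (x y : V) :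
    (cone H).commonNeighbors (some x) (some y) = insert none (some '' H.commonNeighbors x y) := by
  ext (_ | z)
  · simp [SimpleGraph.mem_commonNeighbors, cone]
  · simp [SimpleGraph.mem_commonNeighbors, cone]

/-- The type of a cone consists of the degrees of the base graph and of the numbers of common
neighbours in the base graph, increased by one. -/
theorem mem_graphType_cone {V : Type*} [Finite V] (H : SimpleGraph V) (a : ℕ) :
    a ∈ graphType (cone H) ↔ (∃ x, (H.neighborSet x).ncard = a) ∨
      ∃ x y, x ≠ y ∧ (H.commonNeighbors x y).ncard + 1 = a := by
  have h1 : ∀ x, ((cone H).commonNeighbors none (some x)).ncard = (H.neighborSet x).ncard := by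
    intro x
    rw [commonNeighbors_cone_none, Set.ncard_image_of_injective _ (Option.some_injective V)]
  have h2 : ∀ x y, ((cone H).commonNeighbors (some x) (some y)).ncard =
      (H.commonNeighbors x y).ncard + 1 := by
    intro x y
    rw [commonNeighbors_cone_some, Set.ncard_insert_of_notMem (by simp),
      Set.ncard_image_of_injective _ (Option.some_injective V)]
  constructor
  · rintro ⟨_ | x, _ | y, hne, h⟩
    · exact absurd rfl hne
    · exact Or.inl ⟨y, by rw [← h, h1]⟩
    · exact Or.inl ⟨x, by rw [← h, SimpleGraph.commonNeighbors_symm, h1]⟩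
    · exact Or.inr ⟨x, y, fun e => hne (by rw [e]), by rw [← h, h2]⟩
  · rintro (⟨x, h⟩ | ⟨x, y, hne, h⟩)
    · exact ⟨none, some x, by simp, by rw [h1, h]⟩
    · exact ⟨some x, some y, by simpa using hne, by rw [h2, h]⟩

/-! ### Invariance under isomorphism -/

theorem graphType_subset_of_iso {V W : Type*} {G : SimpleGraph V} {G' : SimpleGraph W}
    (e : G ≃g G') : graphType G ⊆ graphType G' := by
  rintro a ⟨u, v, hne, h⟩
  refine ⟨e u, e v, e.injective.ne hne, ?_⟩
  rw [← h, ← Set.ncard_image_of_injective _ e.injective]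
  congr 1
  ext w
  obtain ⟨w, rfl⟩ := e.surjective w
  rw [e.injective.mem_set_image]
  simp only [SimpleGraph.mem_commonNeighbors, SimpleGraph.Iso.map_adj_iff e]

theorem graphType_eq_of_iso {V W : Type*} {G : SimpleGraph V} {G' : SimpleGraph W}
    (e : G ≃g G') : graphType G = graphType G' :=
  (graphType_subset_of_iso e).antisymm (graphType_subset_of_iso e.symm)

theorem IsVertexConnected.of_iso {V W : Type*} [Fintype V] [Fintype W] {G : SimpleGraph V}
    {G' : SimpleGraph W} {k : ℕ} (e : G ≃g G') (h : IsVertexConnected k G') :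
    IsVertexConnected k G := by
  refine ⟨Fintype.card_congr e.toEquiv ▸ h.1, fun S hS => ?_⟩
  have h' := h.2 (S.map e.toEquiv.toEmbedding) (by simpa using hS)
  let φ : G'.induce (((S.map e.toEquiv.toEmbedding : Finset W) : Set W)ᶜ) →g
      G.induce ((S : Set V)ᶜ) :=
    ⟨fun x => ⟨e.symm x, fun hx => x.2 (by
      simpa using ⟨e.symm x, hx, e.apply_symm_apply _⟩)⟩, fun h => (SimpleGraph.Iso.map_adj_iff e.symm).2 h⟩
  refine h'.map φ ?_
  rintro ⟨x, hx⟩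
  exact ⟨⟨e x, by simpa using hx⟩, Subtype.ext (e.symm_apply_apply x)⟩

/-! ### Graphs without crossing edges -/

/-- No two edges of a graph on linearly ordered vertices cross. -/
def Noncrossing {n : ℕ} (H : SimpleGraph (Fin n)) : Prop :=
  ∀ u v w z, H.Adj u v → H.Adj w z → ¬(u < w ∧ w < v ∧ v < z)

/-- Two common neighbours on the same side, both between `x` and `y` or both outside, would produce
crossing edges. So each of the two sides holds at most one. -/
theorem Noncrossing.ncard_commonNeighbors_le {n : ℕ} {H : SimpleGraph (Fin n)}
    (hH : Noncrossing H) {x y : Fin n} (hxy : x ≠ y) : (H.commonNeighbors x y).ncard ≤ 2 := by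
  wlog hlt : x < y generalizing x y
  · rw [SimpleGraph.commonNeighbors_symm]
    exact this hxy.symm (lt_of_le_of_ne (not_lt.1 hlt) hxy.symm)
  have inner : ∀ u v, u ∈ H.commonNeighbors x y → v ∈ H.commonNeighbors x y → u < v →
      ¬(x < u ∧ v < y) ∧ ¬((u < x ∨ y < u) ∧ (v < x ∨ y < v)) := by
    rintro u v ⟨hu, hu'⟩ ⟨hv, hv'⟩ huv
    simp only [SimpleGraph.mem_neighborSet] at hu hu' hv hv'
    have h1 := hH x v u y hv hu'.symm
    have h2 := hH u x v y hu.symm hv'.symm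
    have h3 := hH u y x v hu'.symm hv
    have h4 := hH x u y v hu hv'
    omega
  by_contra! hc
  obtain ⟨u, v, w, hu, hv, hw, huv, huw, hvw⟩ := (Set.two_lt_ncard_iff (Set.toFinite _)).1 hc
  have ne : ∀ z ∈ H.commonNeighbors x y, z ≠ x ∧ z ≠ y := fun z hz => ⟨hz.1.ne', hz.2.ne'⟩
  have both : ∀ u v, u ∈ H.commonNeighbors x y → v ∈ H.commonNeighbors x y → u ≠ v →
      ¬((x < u ∧ u < y) ↔ (x < v ∧ v < y)) := by
    intro u v hu hv huv
    have := ne u hu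
    have := ne v hv
    rcases lt_or_gt_of_ne huv with h | h
    · have := inner u v hu hv h
      omega
    · have := inner v u hv hu h
      omega
  have h1 := both u v hu hv huv
  have h2 := both u w hu hw huw
  have h3 := both v w hv hw hvw
  tauto

theorem Noncrossing.isPlanar_of_iso {V : Type*} {G : SimpleGraph V} {n : ℕ}
    {H : SimpleGraph (Fin n)} (hH : Noncrossing H) (e : G ≃g cone H) : IsPlanar G := by
  refine isPlanar_of_noncrossing G (fun v => (e v).map Fin.val)
    ((Option.map_injective Fin.val_injective).comp e.injective) ?_
  intro u v w z huv hwz a ha b hb c hc d hd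
  obtain ⟨a, ha', rfl⟩ := Option.mem_map.1 ha
  obtain ⟨b, hb', rfl⟩ := Option.mem_map.1 hb
  obtain ⟨c, hc', rfl⟩ := Option.mem_map.1 hc
  obtain ⟨d, hd', rfl⟩ := Option.mem_map.1 hd
  rw [← SimpleGraph.Iso.map_adj_iff e, Option.mem_def.1 ha', Option.mem_def.1 hb'] at huv
  rw [← SimpleGraph.Iso.map_adj_iff e, Option.mem_def.1 hc', Option.mem_def.1 hd'] at hwz
  exact hH a b c d huv hwz

/-- A graph in which every vertex has at most one smaller neighbour is acyclic. -/
theorem isAcyclic_of_smaller_neighbors {V : Type*} [LinearOrder V] (G : SimpleGraph V)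
    (h : ∀ x y z, G.Adj x y → G.Adj x z → y < x → z < x → y = z) : G.IsAcyclic := by
  intro v p hp
  -- The largest vertex of a cycle would have two distinct smaller neighbours.
  obtain ⟨x, hx, hmax⟩ := p.support.toFinset.exists_max_image id ⟨v, by simp⟩
  rw [List.mem_toFinset] at hx
  have hq := hp.rotate hx
  have hle : ∀ y ∈ (p.rotate x hx).support, y ≤ x := by
    intro y hy
    exact hmax y (by simpa using hy)
  have a1 := (p.rotate x hx).adj_snd hq.not_nil
  have a2 := ((p.rotate x hx).adj_penultimate hq.not_nil).symm
  exact hq.snd_ne_penultimate (h x _ _ a1 a2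
    (lt_of_le_of_ne (hle _ (SimpleGraph.Walk.getVert_mem_support _ _)) a1.ne')
    (lt_of_le_of_ne (hle _ (SimpleGraph.Walk.getVert_mem_support _ _)) a2.ne'))

end PolyhedronType

namespace PolyhedronType

/-! ### A caterpillar placed on a cycle without crossings -/

/-- The chords from the spine vertices `i * M`, `i < m`: one to the next spine vertex, and
`c i - 1` to the vertices `i * M + 2, …, i * M + c i`. -/
def IsChord (c : ℕ → ℕ) (M m x y : ℕ) : Prop :=
  ∃ i < m, x = i * M ∧ x + 2 ≤ y ∧ (y = x + M ∨ y ≤ x + c i)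

/-- The graph whose edges are the chords. -/
def chordGraph (c : ℕ → ℕ) (M m n : ℕ) : SimpleGraph (Fin n) where
  Adj x y := IsChord c M m x y ∨ IsChord c M m y x
  symm := ⟨fun _ _ h => h.symm⟩
  loopless := ⟨by
    rintro x (⟨i, -, -, h, -⟩ | ⟨i, -, -, h, -⟩) <;> omega⟩

/-- The conditions on the parameters under which the chords form a caterpillar, in which `0` and
`m * M` are leaves. -/
structure ChordParams (c : ℕ → ℕ) (M m n : ℕ) : Prop where
  c_zero : c 0 = 1
  c_pos : ∀ i, 1 ≤ c i
  c_lt : ∀ i, c i < M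
  two_le_M : 2 ≤ M
  two_le_m : 2 ≤ m
  lt_n : m * M + 4 < n

theorem cycleGraph_adj_val {n : ℕ} (hn : 3 ≤ n) (u v : Fin n) :
    (SimpleGraph.cycleGraph n).Adj u v ↔ u.val + 1 = v ∨ v.val + 1 = u ∨
      (u.val = 0 ∧ v.val + 1 = n) ∨ (v.val = 0 ∧ u.val + 1 = n) := by
  have hu := u.isLt
  have hv := v.isLt
  rw [SimpleGraph.cycleGraph_adj']
  rcases lt_trichotomy u v with h | h | h
  · have h1 := Fin.coe_sub_iff_lt.2 h
    have h2 := Fin.sub_val_of_le h.le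
    have h3 : u.val < v.val := h
    omega
  · subst h
    have h2 := Fin.sub_val_of_le (le_refl u)
    omega
  · have h1 := Fin.coe_sub_iff_lt.2 h
    have h2 := Fin.sub_val_of_le h.le
    have h3 : v.val < u.val := h
    omega

theorem ncard_neighborSet_cycleGraph {n : ℕ} (hn : 3 ≤ n) (x : Fin n) :
    ((SimpleGraph.cycleGraph n).neighborSet x).ncard = 2 := by
  obtain ⟨n, rfl⟩ := Nat.exists_eq_add_of_le' hn
  rw [← SimpleGraph.cycleGraph_degree_three_le (v := x), Set.ncard_eq_toFinset_card',
    SimpleGraph.degree, SimpleGraph.neighborFinset]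

namespace ChordParams

variable {c : ℕ → ℕ} {M m n : ℕ}

theorem block (P : ChordParams c M m n) {x y : ℕ} (h : IsChord c M m x y) :
    ∃ i < m, x = i * M ∧ x + 2 ≤ y ∧ y ≤ (i + 1) * M ∧ (i + 1) * M ≤ m * M := by
  obtain ⟨i, hi, hx, hy, h⟩ := h
  have := P.c_lt i
  have e := Nat.succ_mul i M
  exact ⟨i, hi, hx, hy, by rw [e]; omega, Nat.mul_le_mul_right M hi⟩

/-- The right end of a chord from `i * M` lies in the half-open block from `i * M` to `(i + 1) * M`,
right end included, and these blocks are disjoint. -/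
theorem left_unique (P : ChordParams c M m n) {x x' y : ℕ} (h : IsChord c M m x y)
    (h' : IsChord c M m x' y) : x = x' := by
  obtain ⟨i, hi, hx, hy, hyi, -⟩ := P.block h
  obtain ⟨j, hj, hx', hy', hyj, -⟩ := P.block h'
  rcases lt_trichotomy i j with hij | hij | hij
  · have := Nat.mul_le_mul_right M (Nat.succ_le_of_lt hij)
    rw [Nat.succ_eq_add_one] at this
    omega
  · rw [hx, hx', hij]
  · have := Nat.mul_le_mul_right M (Nat.succ_le_of_lt hij)
    rw [Nat.succ_eq_add_one] at this
    omega

theorem isChord_spine_iff (P : ChordParams c M m n) (i j : ℕ) :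
    IsChord c M m (i * M) (j * M) ↔ i < m ∧ i + 1 = j := by
  have hM := P.two_le_M
  constructor
  · intro h
    obtain ⟨k, hk, hik, hlt, hle, -⟩ := P.block h
    obtain rfl : i = k := Nat.eq_of_mul_eq_mul_right (by omega) hik
    have h1 : j ≤ i + 1 := Nat.le_of_mul_le_mul_right hle (by omega)
    have h2 : i < j := Nat.lt_of_mul_lt_mul_right (a := M) (by omega)
    omega
  · rintro ⟨hi, rfl⟩
    have e := Nat.succ_mul i M
    exact ⟨i, hi, rfl, by rw [e]; omega, Or.inl e⟩

theorem disjoint_cycleGraph (P : ChordParams c M m n) :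
    Disjoint (chordGraph c M m n) (SimpleGraph.cycleGraph n) := by
  have hn := P.lt_n
  have key : ∀ x y : Fin n, IsChord c M m x y → ¬(SimpleGraph.cycleGraph n).Adj x y := by
    intro x y h hc
    obtain ⟨i, hi, hx, hy, hyi, him⟩ := P.block h
    rw [cycleGraph_adj_val (by omega)] at hc
    omega
  rw [disjoint_iff_inf_le]
  rintro x y ⟨h | h, hc⟩
  · exact key x y h hc
  · exact key y x h hc.symm

theorem noncrossing (P : ChordParams c M m n) :
    Noncrossing (SimpleGraph.cycleGraph n ⊔ chordGraph c M m n) := by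
  have hn := P.lt_n
  have key : ∀ u v : Fin n, u < v → (SimpleGraph.cycleGraph n ⊔ chordGraph c M m n).Adj u v →
      (u.val + 1 = v ∨ (u.val = 0 ∧ v.val + 1 = n)) ∨ IsChord c M m u v := by
    rintro u v huv (h | h | h)
    · rw [cycleGraph_adj_val (by omega)] at h
      left; omega
    · exact Or.inr h
    · obtain ⟨i, hi, hx, hy, -⟩ := P.block h
      omega
  rintro u v w z huv hwz ⟨h1, h2, h3⟩
  have hz := z.isLt
  rcases key u v (h1.trans h2) huv with h | h
  · omega
  · rcases key w z (h2.trans h3) hwz with h' | h'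
    · omega
    · obtain ⟨i, hi, hx, hy, hyi, -⟩ := P.block h
      obtain ⟨j, hj, hx', hy', hyj, -⟩ := P.block h'
      -- A chord starting at a later spine vertex starts no earlier than `(i + 1) * M`, where the
      -- first chord has already ended.
      have hij : i < j := Nat.lt_of_mul_lt_mul_right (a := M) (by omega)
      have := Nat.mul_le_mul_right M (Nat.succ_le_of_lt hij)
      rw [Nat.succ_eq_add_one] at this
      omega

theorem isAcyclic (P : ChordParams c M m n) : (chordGraph c M m n).IsAcyclic := by
  refine isAcyclic_of_smaller_neighbors _ ?_
  have key : ∀ x y : Fin n, (chordGraph c M m n).Adj x y → y < x → IsChord c M m y x := by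
    rintro x y (h | h) hlt
    · obtain ⟨i, hi, hx, hy, -⟩ := P.block h
      omega
    · exact h
  intro x y z hy hz hyx hzx
  exact Fin.ext (P.left_unique (key x y hy hyx) (key x z hz hzx))

/-! ### Vertex degrees and the type of the cone. -/

/-- The number of chords at a vertex `(i + 1) * M`, an inner vertex of the caterpillar. -/
theorem ncard_neighborSet_spine (P : ChordParams c M m n) {i : ℕ} (hi : i + 1 < m) (x : Fin n)
    (hx : x.val = (i + 1) * M) :
    ((chordGraph c M m n).neighborSet x).ncard = c (i + 1) + 1 := by
  have hn := P.lt_n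
  have hM := P.two_le_M
  have hc := P.c_lt (i + 1)
  have hc' := P.c_pos (i + 1)
  have e1 : (i + 1) * M = i * M + M := Nat.succ_mul i M
  have e2 : (i + 1 + 1) * M = (i + 1) * M + M := Nat.succ_mul (i + 1) M
  have hle : (i + 1 + 1) * M ≤ m * M := Nat.mul_le_mul_right M hi
  have himg : Fin.val '' (chordGraph c M m n).neighborSet x =
      ((insert (i * M) (insert ((i + 1 + 1) * M)
        (Finset.Icc ((i + 1) * M + 2) ((i + 1) * M + c (i + 1)))) : Finset ℕ) : Set ℕ) := by
    ext y
    simp only [Set.mem_image, SimpleGraph.mem_neighborSet, Finset.coe_insert, Finset.coe_Icc,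
      Set.mem_insert_iff, Set.mem_Icc]
    constructor
    · rintro ⟨y, h | h, rfl⟩
      · obtain ⟨j, hj, hxj, hy, h⟩ := h
        obtain rfl : i + 1 = j := Nat.eq_of_mul_eq_mul_right (by omega) (hx.symm.trans hxj)
        omega
      · left
        refine P.left_unique h ?_
        rw [hx, P.isChord_spine_iff]
        omega
    · rintro (h | h | h)
      · refine ⟨⟨y, by omega⟩, Or.inr ?_, rfl⟩
        change IsChord c M m y x
        rw [hx, h, P.isChord_spine_iff]
        omega
      · refine ⟨⟨y, by omega⟩, Or.inl ?_, rfl⟩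
        change IsChord c M m x y
        rw [hx, h, P.isChord_spine_iff]
        omega
      · refine ⟨⟨y, by omega⟩, Or.inl ?_, rfl⟩
        change IsChord c M m x y
        exact ⟨i + 1, hi, hx, by omega, by right; omega⟩
  rw [← Set.ncard_image_of_injective _ Fin.val_injective, himg, Set.ncard_coe_finset,
    Finset.card_insert_of_notMem, Finset.card_insert_of_notMem, Nat.card_Icc]
  · omega
  · simp only [Finset.mem_Icc]; omega
  · simp only [Finset.mem_insert, Finset.mem_Icc]; omega

theorem ncard_neighborSet_le_one (P : ChordParams c M m n) (x : Fin n)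
    (hx : ∀ i, i + 1 < m → x.val ≠ (i + 1) * M) :
    ((chordGraph c M m n).neighborSet x).ncard ≤ 1 := by
  have hzero : ∀ y, IsChord c M m x y → x.val = 0 ∧ y = M := by
    rintro y ⟨i, hi, hxi, hy, h⟩
    -- The only spine vertex with a chord to the right that is not excluded is 0; as `c 0 = 1`, its
    -- sole chord goes to `M`.
    obtain rfl : i = 0 := by
      by_contra h0
      obtain ⟨i, rfl⟩ := Nat.exists_eq_succ_of_ne_zero h0
      exact hx i hi hxi
    have := P.c_zero
    omega
  rw [Set.ncard_le_one_iff]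
  rintro y z (hy | hy) (hz | hz)
  · exact Fin.ext ((hzero _ hy).2.trans (hzero _ hz).2.symm)
  · obtain ⟨i, -, -, h, -⟩ := hz
    have := (hzero _ hy).1
    omega
  · obtain ⟨i, -, -, h, -⟩ := hy
    have := (hzero _ hz).1
    omega
  · exact Fin.ext (P.left_unique hy hz)

theorem ncard_neighborSet_sup (P : ChordParams c M m n) (x : Fin n) :
    ((SimpleGraph.cycleGraph n ⊔ chordGraph c M m n).neighborSet x).ncard =
      2 + ((chordGraph c M m n).neighborSet x).ncard := by
  have hn := P.lt_n
  rw [SimpleGraph.neighborSet_sup, Set.ncard_union_eq _ (Set.toFinite _) (Set.toFinite _),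
    ncard_neighborSet_cycleGraph (by omega)]
  rw [Set.disjoint_left]
  intro y h h'
  exact P.disjoint_cycleGraph.le_bot ⟨h', h⟩

/-- The numbers of chords at the vertices. -/
theorem ncard_neighborSet_cases (P : ChordParams c M m n) (x : Fin n) :
    ((chordGraph c M m n).neighborSet x).ncard ≤ 1 ∨
      ∃ i, i + 1 < m ∧ x.val = (i + 1) * M ∧
        ((chordGraph c M m n).neighborSet x).ncard = c (i + 1) + 1 := by
  by_cases h : ∃ i, i + 1 < m ∧ x.val = (i + 1) * M
  · obtain ⟨i, hi, hx⟩ := h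
    exact Or.inr ⟨i, hi, hx, P.ncard_neighborSet_spine hi x hx⟩
  · push Not at h
    exact Or.inl (P.ncard_neighborSet_le_one x h)

theorem not_adj_of_lt (P : ChordParams c M m n) {x y : Fin n} (hx : m * M < x.val) :
    ¬(chordGraph c M m n).Adj x y := by
  rintro (h | h) <;>
  · obtain ⟨i, hi, hx, hy, hyi, him⟩ := P.block h
    omega

theorem mem_graphType_iff (P : ChordParams c M m n) (a : ℕ) :
    a ∈ graphType (cone (SimpleGraph.cycleGraph n ⊔ chordGraph c M m n)) ↔
      (a = 1 ∨ a = 2 ∨ a = 3) ∨ ∃ i, i + 1 < m ∧ c (i + 1) + 3 = a := by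
  have hn := P.lt_n
  have hm := P.two_le_m
  have hM := P.two_le_M
  have hMm : 2 * M ≤ m * M := Nat.mul_le_mul_right M hm
  rw [mem_graphType_cone]
  constructor
  · rintro (⟨x, h⟩ | ⟨x, y, hne, h⟩)
    · rw [P.ncard_neighborSet_sup] at h
      rcases P.ncard_neighborSet_cases x with h' | ⟨i, hi, -, h'⟩
      · left; omega
      · exact Or.inr ⟨i, hi, by omega⟩
    · have := P.noncrossing.ncard_commonNeighbors_le hne
      left; omega
  · rintro ((rfl | rfl | rfl) | ⟨i, hi, rfl⟩)
    · right
      -- Consecutive vertices beyond the last chord share no neighbour; `m * M + 4 < n` rules out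
      -- wrapping around.
      refine ⟨⟨m * M + 2, by omega⟩, ⟨m * M + 3, by omega⟩, by simp, ?_⟩
      rw [Nat.add_eq_right, Set.ncard_eq_zero, Set.eq_empty_iff_forall_notMem]
      rintro z ⟨h1 | h1, h2 | h2⟩
      · rw [cycleGraph_adj_val (by omega)] at h1 h2
        simp only at h1 h2
        omega
      · exact P.not_adj_of_lt (by simp) h2
      · exact P.not_adj_of_lt (by simp) h1
      · exact P.not_adj_of_lt (by simp) h1
    · left
      refine ⟨⟨m * M + 2, by omega⟩, ?_⟩
      rw [P.ncard_neighborSet_sup, Nat.add_eq_left, Set.ncard_eq_zero,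
        Set.eq_empty_iff_forall_notMem]
      exact fun z h => P.not_adj_of_lt (by simp) h
    · left
      refine ⟨⟨0, by omega⟩, ?_⟩
      rw [P.ncard_neighborSet_sup]
      have h1 := P.ncard_neighborSet_le_one ⟨0, by omega⟩ (by
        intro i _ h
        have := Nat.succ_mul i M
        simp only [Nat.succ_eq_add_one] at this h
        omega)
      have h2 : ((chordGraph c M m n).neighborSet ⟨0, by omega⟩).ncard ≠ 0 :=
        Set.ncard_ne_zero_of_mem (a := (⟨M, by omega⟩ : Fin n))
          (Or.inl ⟨0, by omega, by simp, by simpa using hM, Or.inl (by simp)⟩)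
      omega
    · left
      have hle : (i + 1) * M ≤ m * M := Nat.mul_le_mul_right M hi.le
      refine ⟨⟨(i + 1) * M, by omega⟩, ?_⟩
      rw [P.ncard_neighborSet_sup, P.ncard_neighborSet_spine hi _ rfl]
      omega

/-! ### The chords form a caterpillar on their support. -/

theorem spine_lt (P : ChordParams c M m n) {i : ℕ} (hi : i ≤ m) : i * M < n := by
  have := Nat.mul_le_mul_right M hi
  have := P.lt_n
  omega

theorem spine_mem_support (P : ChordParams c M m n) {i : ℕ} (hi : i ≤ m) :
    (⟨i * M, P.spine_lt hi⟩ : Fin n) ∈ (chordGraph c M m n).support := by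
  have hm := P.two_le_m
  rcases hi.lt_or_eq with h | h
  · exact ⟨⟨(i + 1) * M, P.spine_lt h⟩, Or.inl ((P.isChord_spine_iff i (i + 1)).2 ⟨h, rfl⟩)⟩
  · exact ⟨⟨(i - 1) * M, P.spine_lt (by omega)⟩,
      Or.inr ((P.isChord_spine_iff (i - 1) i).2 ⟨by omega, by omega⟩)⟩

/-- Restricting to the support discards isolated vertices. Every chord starts on the spine, which
gives connectedness; the vertices of degree other than 1 are the inner spine vertices. -/
theorem isCaterpillar_comap (P : ChordParams c M m n) {k : ℕ} (f : Fin k ↪ Fin n)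
    (hf : Set.range f = (chordGraph c M m n).support) :
    IsCaterpillar ((chordGraph c M m n).comap f) := by
  have hm := P.two_le_m
  have hM := P.two_le_M
  have hspine : ∀ i, i ≤ m → ∃ a, (f a).val = i * M := by
    intro i hi
    have h := P.spine_mem_support hi
    rw [← hf] at h
    obtain ⟨a, ha⟩ := h
    exact ⟨a, by rw [ha]⟩
  have hncard : ∀ a, (((chordGraph c M m n).comap f).neighborSet a).ncard =
      ((chordGraph c M m n).neighborSet (f a)).ncard := by
    intro a
    refine Set.ncard_preimage_of_injective_subset_range (f := f)
      (s := (chordGraph c M m n).neighborSet (f a)) f.injective ?_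
    rw [hf]
    exact fun y hy => (SimpleGraph.mem_support _).2 ⟨f a, SimpleGraph.Adj.symm hy⟩
  obtain ⟨r, hr⟩ := hspine 0 (by omega)
  have hreach : ∀ i, i ≤ m → ∀ a, (f a).val = i * M →
      ((chordGraph c M m n).comap f).Reachable r a := by
    intro i
    induction i with
    | zero =>
      intro _ a ha
      rw [f.injective (Fin.ext (ha.trans hr.symm))]
    | succ i ih =>
      intro hi a ha
      obtain ⟨b, hb⟩ := hspine i (by omega)
      refine (ih (by omega) b hb).trans (SimpleGraph.Adj.reachable (Or.inl ?_))
      rw [ha, hb, P.isChord_spine_iff]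
      omega
  have hinner : ∀ a, (((chordGraph c M m n).comap f).neighborSet a).ncard ≠ 1 ↔
      ∃ i, i + 1 < m ∧ (f a).val = (i + 1) * M := by
    intro a
    rw [hncard]
    constructor
    · intro h
      rcases P.ncard_neighborSet_cases (f a) with h' | ⟨i, hi, hx, -⟩
      · have hmem : f a ∈ (chordGraph c M m n).support := hf ▸ Set.mem_range_self a
        obtain ⟨y, hy⟩ := hmem
        have := Set.ncard_ne_zero_of_mem (s := (chordGraph c M m n).neighborSet (f a)) hy
        omega
      · exact ⟨i, hi, hx⟩
    · rintro ⟨i, hi, hx⟩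
      rw [P.ncard_neighborSet_spine hi _ hx]
      have := P.c_pos (i + 1)
      omega
  refine ⟨⟨?_, P.isAcyclic.of_comap f⟩, m - 1, by omega, ?_⟩
  · refine (SimpleGraph.connected_iff_exists_forall_reachable _).2 ⟨r, fun a => ?_⟩
    have hmem : f a ∈ (chordGraph c M m n).support := hf ▸ Set.mem_range_self a
    obtain ⟨y, h | h⟩ := hmem
    · obtain ⟨i, hi, hx, -⟩ := P.block h
      exact hreach i hi.le a hx
    · obtain ⟨i, hi, hx, -⟩ := P.block h
      obtain ⟨b, hb⟩ := hspine i hi.le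
      refine (hreach i hi.le b hb).trans (SimpleGraph.Adj.reachable (Or.inl ?_))
      rwa [hb, ← hx]
  · have : Nonempty (Fin k) := ⟨r⟩
    choose! g hg using hspine
    -- The shift by one skips the leaf 0; the other spine end `m * M` is a leaf too, so `m - 1`
    -- vertices remain.
    let φ : Fin (m - 1) → {v | (((chordGraph c M m n).comap f).neighborSet v).ncard ≠ 1} :=
      fun i => ⟨g (i + 1), (hinner _).2 ⟨i, by omega, hg _ (by omega)⟩⟩
    have hφ : ∀ i, (f (φ i)).val = (i.val + 1) * M := fun i => hg _ (by omega)
    have hbij : Function.Bijective φ := by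
      constructor
      · intro i j h
        have h1 := hφ i
        rw [h, hφ j] at h1
        have := Nat.eq_of_mul_eq_mul_right (by omega) h1
        exact Fin.ext (by omega)
      · rintro ⟨a, ha⟩
        obtain ⟨i, hi, hx⟩ := (hinner a).1 ha
        exact ⟨⟨i, by omega⟩, Subtype.ext (f.injective (Fin.ext ((hφ _).trans hx.symm)))⟩
    refine ⟨(RelIso.mk (Equiv.ofBijective φ hbij) ?_).symm⟩
    intro i j
    change (IsChord c M m (f (φ i)) (f (φ j)) ∨ IsChord c M m (f (φ j)) (f (φ i))) ↔ _
    rw [hφ, hφ, P.isChord_spine_iff, P.isChord_spine_iff, SimpleGraph.pathGraph_adj]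
    omega

theorem isPyramidWithCaterpillar_of_iso (P : ChordParams c M m n) {V : Type*} {G : SimpleGraph V}
    (e : G ≃g cone (SimpleGraph.cycleGraph n ⊔ chordGraph c M m n)) :
    IsPyramidWithCaterpillar G := by
  have hn := P.lt_n
  obtain ⟨k, ⟨ε⟩⟩ := Finite.exists_equiv_fin (chordGraph c M m n).support
  let f : Fin k ↪ Fin n := ε.symm.toEmbedding.trans (Function.Embedding.subtype _)
  have hf : Set.range f = (chordGraph c M m n).support := by
    ext x
    constructor
    · rintro ⟨a, rfl⟩
      exact (ε.symm a).2
    · intro hx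
      exact ⟨ε ⟨x, hx⟩, by simp [f]⟩
  have hmap : ((chordGraph c M m n).comap f).map f = chordGraph c M m n := by
    ext x y
    rw [SimpleGraph.map_adj]
    constructor
    · rintro ⟨a, b, h, rfl, rfl⟩
      exact h
    · intro h
      have hx : x ∈ Set.range f := hf ▸ ⟨y, h⟩
      have hy : y ∈ Set.range f := hf ▸ ⟨x, h.symm⟩
      obtain ⟨a, rfl⟩ := hx
      obtain ⟨b, rfl⟩ := hy
      exact ⟨a, b, h, rfl, rfl⟩
  refine ⟨n, by omega, k, (chordGraph c M m n).comap f, f, P.isCaterpillar_comap f hf, ?_, ?_⟩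
  · rw [hmap]
    exact P.disjoint_cycleGraph
  · rw [hmap]
    exact ⟨e⟩

theorem isPolyhedron_of_iso (P : ChordParams c M m n) {V : Type*} [Fintype V] {G : SimpleGraph V}
    (e : G ≃g cone (SimpleGraph.cycleGraph n ⊔ chordGraph c M m n)) : IsPolyhedron G := by
  refine ⟨P.noncrossing.isPlanar_of_iso e, ?_⟩
  have hn := P.lt_n
  obtain ⟨n, rfl⟩ : ∃ n', n = n' + 3 := ⟨n - 3, by omega⟩
  exact (isVertexConnected_cone _ le_sup_left).of_iso e

end ChordParams

end PolyhedronType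

/-! ### Choice of parameters and conclusion. -/

open PolyhedronType in
theorem exists_chordParams (A' : Finset ℕ) (hne : A'.Nonempty) (h4 : ∀ a ∈ A', 4 ≤ a) :
    ∃ (c : ℕ → ℕ) (M m : ℕ), (∀ n, m * M + 4 < n → ChordParams c M m n) ∧
      ∀ a, (∃ i, i + 1 < m ∧ c (i + 1) + 3 = a) ↔ a ∈ A' := by
  obtain ⟨a₀, ha₀⟩ := hne
  have hle : ∀ a ∈ A', a ≤ A'.sup id := fun a ha => Finset.le_sup (f := id) ha
  have h4₀ := h4 a₀ ha₀
  have hle₀ := hle a₀ ha₀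
  -- Each `a ∈ A'` is realised at spine index `a`; the remaining inner indices repeat `a₀`.
  refine ⟨fun i => if i = 0 then 1 else if i ∈ A' then i - 3 else a₀ - 3, A'.sup id + 1,
    A'.sup id + 1, fun n hn => ⟨by simp, fun i => ?_, fun i => ?_, by omega, by omega, hn⟩,
    fun a => ?_⟩
  · split_ifs with h h'
    · exact le_rfl
    · have := h4 i h'
      omega
    · omega
  · split_ifs with h h'
    · omega
    · have := hle i h'
      omega
    · omega
  · simp only [Nat.add_eq_zero_iff, one_ne_zero, and_false, if_false]
    constructor
    · rintro ⟨i, hi, rfl⟩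
      split_ifs with h
      · rwa [Nat.sub_add_cancel (by have := h4 _ h; omega)]
      · rwa [Nat.sub_add_cancel (by omega)]
    · intro ha
      have h1 := h4 a ha
      have h2 := hle a ha
      refine ⟨a - 1, by omega, ?_⟩
      rw [Nat.sub_add_cancel (by omega), if_pos ha]
      omega

theorem mainTheorem10 (A' : Finset ℕ) (hne : A'.Nonempty) (h4 : ∀ a ∈ A', 4 ≤ a) :
    ∃ (p : ℕ → ℕ) (G : (i : ℕ) → SimpleGraph (Fin (p i))),
      (∀ i j, i ≠ j → IsEmpty (G i ≃g G j)) ∧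
      ∀ i, PolyhedronType.IsPolyhedron (G i) ∧
        PolyhedronType.graphType (G i) = ({1, 2, 3} : Set ℕ) ∪ (A' : Set ℕ) ∧
        PolyhedronType.IsPyramidWithCaterpillar (G i) := by
  obtain ⟨c, M, m, hP, hA⟩ := exists_chordParams A' hne h4
  let H : (j : ℕ) → SimpleGraph (Option (Fin (m * M + 5 + j))) := fun j =>
    PolyhedronType.cone (SimpleGraph.cycleGraph _ ⊔ PolyhedronType.chordGraph c M m _)
  -- The final `+ 1` counts the apex. Distinct `j` give distinct orders, hence non-isomorphic
  -- graphs.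
  refine ⟨fun j => m * M + 5 + j + 1, fun j => (H j).comap (finSuccEquiv (m * M + 5 + j)),
    fun i j hij => ⟨fun e => hij ?_⟩, fun j => ?_⟩
  · have := Fintype.card_congr e.toEquiv
    simp only [Fintype.card_fin] at this
    omega
  · have e : (H j).comap (finSuccEquiv (m * M + 5 + j)) ≃g H j := SimpleGraph.Iso.comap _ _
    have P := hP (m * M + 5 + j) (by omega)
    refine ⟨P.isPolyhedron_of_iso e, ?_, P.isPyramidWithCaterpillar_of_iso e⟩
    rw [PolyhedronType.graphType_eq_of_iso e]
    ext a
    rw [P.mem_graphType_iff, hA]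
    simp
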